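/- Let $q\ge 1$, let $n_1,\dots,n_q\ge 1$ be integers, $n=\sum_i n_i$, and partition $n\times n$ real matrices into blocks $M_{ij}\in\mathbb R^{n_i\times n_j}$. Let $G_{\mathcal P}$ (plant graph) and $G_{\mathcal K}$ (control graph) be directed graphs on $\{1,\dots,q\}$, possibly with self-loops, and let $\epsilon>0$. Let $\mathcal A$ be the set of $A\in\mathbb R^{n\times n}$ with $A_{ij}=0$ whenever $(j,i)$ is not an edge of $G_{\mathcal P}$; let $\mathcal K$ be the set of $K\in\mathbb R^{n\times n}$ with $K_{ij}=0$ whenever $(j,i)$ is not an edge of $G_{\mathcal K}$. Let $\mathcal B$ be either the set of block-diagonal matrices $B=\mathrm{diag}(B_{11},\dots,B_{qq})$ whose smallest singular value is at least $\epsilon$, or the set of diagonal matrices with all diagonal entries at least $\epsilon$. The set of plants is $\mathcal P=\mathcal A\times\mathcal B\times\mathbb R^n$; a plant $P=(A,B,x_0)$ stands for $x(k+1)=Ax(k)+Bu(k)$, $x(0)=x_0$. Fix symmetric positive definite block-diagonal matrices $Q,R$ (for instance $Q=R=I$); the cost of $K\in\mathcal K$ is $$J_P(K)=\sum_{k=1}^\infty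 x(k)^TQx(k)+\sum_{k=0}^\infty u(k)^TRu(k)\in[0,\infty],\qquad u(k)=Kx(k).$$ A control design method is a map $\Gamma:\mathcal P\to\mathcal K$. It is communication-less (its design graph is the totally disconnected graph with self-loops) if, for every $i$, the block row $[\Gamma_{i1}\ \cdots\ \Gamma_{iq}]$ is a function of $[A_{i1}\ \cdots\ A_{iq}]$ and $B_{ii}$ only. Let $\mathcal C$ be the set of communication-less methods. A method $\Gamma$ dominates $\Gamma'$ if $J_P(\Gamma(P))\le J_P(\Gamma'(P))$ for all $P\in\mathcal P$, with strict inequality for at least one $P$; $\Gamma'\in\mathcal C$ is undominated in $\mathcal C$ if no $\Gamma\in\mathcal C$ dominates it. A node $i$ is a sink if there is no edge $(i,j)$ with $j\ne i$, and isolated if there is no edge $(i,j)$ or $(j,i)$ with $j\neq i$. The deadbeat method is $\Gamma^\Delta(A,B)=-B^{-1}A$. **Theorem.** Suppose that $G_{\mathcal P}$ has no isolated node and that every edge of $G_{\mathcal P}$ is an edge of $G_{\mathcal K}$. Then $\Gamma^\Delta\in\mathcal C$, and $\Gamma^\Delta$ is undominated in $\mathcal C$ for plants in $\mathcal P$ if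 and only if $G_{\mathcal P}$ has no sink. -/

import Mathlib

open scoped ENNReal Matrix

noncomputable section

namespace LimitedModelInfo

/-- Indices of the aggregate state: `⟨i, k⟩` is the `k`-th coordinate of subsystem `i`, where
subsystem `i` has dimension `n i`; the total dimension is `∑ i, n i`. -/
abbrev StateIdx {q : ℕ} (n : Fin q → ℕ) : Type := (i : Fin q) × Fin (n i)

/-- Real matrices of total size `(∑ i, n i) × (∑ i, n i)`; the block `(i, j)` of `M` consists of
the entries `M ⟨i, k⟩ ⟨j, l⟩`. -/
abbrev SysMatrix {q : ℕ} (n : Fin q → ℕ) : Type := Matrix (StateIdx n) (StateIdx n) ℝ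

/-- A vertex with no edge leaving it towards another vertex (self-loops are disregarded). -/
def IsSink {q : ℕ} (G : Digraph (Fin q)) (i : Fin q) : Prop :=
  ∀ j, j ≠ i → ¬ G.Adj i j

/-- A vertex with no edge to or from another vertex (self-loops are disregarded). -/
def IsIsolated {q : ℕ} (G : Digraph (Fin q)) (i : Fin q) : Prop :=
  ∀ j, j ≠ i → ¬ G.Adj i j ∧ ¬ G.Adj j i

/-- The totally disconnected graph with self-loops. -/
def selfLoopGraph (q : ℕ) : Digraph (Fin q) where
  Adj i j := i = j

/-- Matrices whose block `(i, j)` vanishes unless `(j, i)` is an edge of `G`. For the plant graph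
this is the set of admissible `A`, for the control graph the set of admissible controllers `K`. -/
def structuredMatrices {q : ℕ} (n : Fin q → ℕ) (G : Digraph (Fin q)) : Set (SysMatrix n) :=
  {M | ∀ i j, ¬ G.Adj j i → ∀ (k : Fin (n i)) (l : Fin (n j)), M ⟨i, k⟩ ⟨j, l⟩ = 0}

/-- Block-diagonal matrices. -/
def IsBlockDiag {q : ℕ} {n : Fin q → ℕ} (M : SysMatrix n) : Prop :=
  ∀ i j, i ≠ j → ∀ (k : Fin (n i)) (l : Fin (n j)), M ⟨i, k⟩ ⟨j, l⟩ = 0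

/-- Block-diagonal matrices all of whose singular values are at least `ε`. (The `∑ i, n i`
singular values are those with index below the dimension; the later ones are zero by convention.) -/
def inputMatrices {q : ℕ} (n : Fin q → ℕ) (ε : ℝ) : Set (SysMatrix n) :=
  {B | IsBlockDiag B ∧
    ∀ m < Fintype.card (StateIdx n), ε ≤ (Matrix.toEuclideanLin B).singularValues m}

/-- Diagonal matrices with diagonal entries at least `ε`. -/
def diagInputMatrices {q : ℕ} (n : Fin q → ℕ) (ε : ℝ) : Set (SysMatrix n) :=
  {B | B.IsDiag ∧ ∀ a, ε ≤ B a a}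

/-- Plants `x(k+1) = A x(k) + B u(k)`, `x(0) = x₀`, with `A` structured according to the plant
graph and `B` in the set `𝓑` of input matrices. -/
structure Plant {q : ℕ} (n : Fin q → ℕ) (GP : Digraph (Fin q)) (𝓑 : Set (SysMatrix n)) where
  A : SysMatrix n
  B : SysMatrix n
  x₀ : StateIdx n → ℝ
  A_mem : A ∈ structuredMatrices n GP
  B_mem : B ∈ 𝓑

section
variable {q : ℕ} {n : Fin q → ℕ} {GP : Digraph (Fin q)} {𝓑 : Set (SysMatrix n)}

/-- Closed-loop state trajectory under the static feedback `u(k) = K x(k)`. -/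
def Plant.state (P : Plant n GP 𝓑) (K : SysMatrix n) : ℕ → StateIdx n → ℝ
  | 0 => P.x₀
  | k + 1 => P.A *ᵥ P.state K k + P.B *ᵥ (K *ᵥ P.state K k)

/-- The input `u(k) = K x(k)`. -/
def Plant.input (P : Plant n GP 𝓑) (K : SysMatrix n) (k : ℕ) : StateIdx n → ℝ :=
  K *ᵥ P.state K k

/-- The cost `∑_{k ≥ 1} x(k)ᵀ Q x(k) + ∑_{k ≥ 0} u(k)ᵀ R u(k)`, which may be `+∞`. It is used for
positive definite `Q` and `R` only, so all the terms are nonnegative. -/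
def cost (Q R : SysMatrix n) (P : Plant n GP 𝓑) (K : SysMatrix n) : ℝ≥0∞ :=
  (∑' k : ℕ, ENNReal.ofReal (P.state K (k + 1) ⬝ᵥ (Q *ᵥ P.state K (k + 1)))) +
    ∑' k : ℕ, ENNReal.ofReal (P.input K k ⬝ᵥ (R *ᵥ P.input K k))

/-- Two plants have the same model of subsystem `j`: the same block row `[A_{j1} ⋯ A_{jq}]` and
the same block `B_{jj}`. -/
def SameModel (j : Fin q) (P P' : Plant n GP 𝓑) : Prop :=
  (∀ (k : Fin (n j)) (b : StateIdx n), P.A ⟨j, k⟩ b = P'.A ⟨j, k⟩ b) ∧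
    ∀ k l : Fin (n j), P.B ⟨j, k⟩ ⟨j, l⟩ = P'.B ⟨j, k⟩ ⟨j, l⟩

/-- The control design methods with structure `GC`: maps from plants to controllers structured
according to `GK` such that, for each `i`, the block row `i` of the controller is a function of
the models of those subsystems `j` for which `(j, i)` is an edge of `GC`. -/
def designMethods (n : Fin q → ℕ) (GP GK GC : Digraph (Fin q)) (𝓑 : Set (SysMatrix n)) :
    Set (Plant n GP 𝓑 → SysMatrix n) :=
  {Γ | (∀ P, Γ P ∈ structuredMatrices n GK) ∧
    ∀ (i : Fin q) (P P' : Plant n GP 𝓑), (∀ j, GC.Adj j i → SameModel j P P') →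
      ∀ (k : Fin (n i)) (b : StateIdx n), Γ P ⟨i, k⟩ b = Γ P' ⟨i, k⟩ b}

/-- `Γ` dominates `Γ'`: never a larger cost, and a strictly smaller one for some plant. -/
def Dominates (Q R : SysMatrix n) (Γ Γ' : Plant n GP 𝓑 → SysMatrix n) : Prop :=
  (∀ P, cost Q R P (Γ P) ≤ cost Q R P (Γ' P)) ∧ ∃ P, cost Q R P (Γ P) < cost Q R P (Γ' P)

/-- `Γ'` belongs to the class `𝒞` and no member of `𝒞` dominates it. -/
def IsUndominatedIn (Q R : SysMatrix n) (𝒞 : Set (Plant n GP 𝓑 → SysMatrix n))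
    (Γ' : Plant n GP 𝓑 → SysMatrix n) : Prop :=
  Γ' ∈ 𝒞 ∧ ¬ ∃ Γ ∈ 𝒞, Dominates Q R Γ Γ'

/-- The deadbeat control design method `(A, B) ↦ -B⁻¹ A`. -/
def deadbeat (P : Plant n GP 𝓑) : SysMatrix n := -(P.B⁻¹ * P.A)

end

end LimitedModelInfo

end

/-! The deadbeat law makes `A + BK = 0`, so the state vanishes after one step and the cost is that
of `u(0)` alone (`InputSet.cost_deadbeat`).

With a sink, deadbeat overspends. A sink that only follows a coordinate of another subsystem may
leave a small residual state: the residual feeds nobody, itself included, and disappears one step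
later for free. Shrinking the gain by `1 - δ` saves input cost to first order in `δ` and costs state
to second order (`InputSet.cost_relaxedDeadbeat`). Only the sink's own model is needed to recognise
this situation, so the modified method is communication-less.

Without sinks, suppose `Γ` is not deadbeat at `P`, so that some coordinate `a` has a nonzero
closed-loop row. Its subsystem has an out-neighbour, whose model can be changed without `Γ` changing
the row block of `a`. Let the neighbour amplify `a` by a large gain `r`, with a large input block `β
I`: a nonzero `x(1)` at `a` forces a cost of order `r²/β²` that deadbeat never pays, and the lower
bound at time 0 nearly matches what deadbeat pays there (`step_cost_lower_bound`,
`InputSet.exists_cost_deadbeat_lt`). -/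

namespace LimitedModelInfo

/-! ### Properties shared by the two sets of input matrices. -/

section InputMatrices

variable {q : ℕ} {n : Fin q → ℕ}

/-- All singular values of a square matrix are at least `ε > 0` if and only if the matrix
expands Euclidean norms by a factor of at least `ε`. -/
theorem forall_le_singularValues_iff {ι : Type*} [Fintype ι] [DecidableEq ι] {ε : ℝ} (hε : 0 < ε)
    (B : Matrix ι ι ℝ) :
    (∀ m < Fintype.card ι, ε ≤ (Matrix.toEuclideanLin B).singularValues m) ↔
      ∀ x : ι → ℝ, ε ^ 2 * (x ⬝ᵥ x) ≤ (B *ᵥ x) ⬝ᵥ (B *ᵥ x) := by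
  set T := Matrix.toEuclideanLin B with hT
  have hcard : Module.finrank ℝ (EuclideanSpace ℝ ι) = Fintype.card ι := finrank_euclideanSpace
  have hS := T.isSymmetric_adjoint_comp_self
  have hnorm : ∀ x : ι → ℝ, x ⬝ᵥ x = ‖WithLp.toLp 2 x‖ ^ 2 := by
    intro x
    rw [EuclideanSpace.real_norm_sq_eq]
    simp [dotProduct, sq]
  have hTx : ∀ x : EuclideanSpace ℝ ι,
      inner ℝ ((T.adjoint ∘ₗ T) x) x = ‖T x‖ ^ 2 := by
    intro x
    rw [LinearMap.comp_apply, LinearMap.adjoint_inner_left, real_inner_self_eq_norm_sq]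
  have key : (∀ x : ι → ℝ, ε ^ 2 * (x ⬝ᵥ x) ≤ (B *ᵥ x) ⬝ᵥ (B *ᵥ x)) ↔
      ∀ x : EuclideanSpace ℝ ι, ε ^ 2 * ‖x‖ ^ 2 ≤ ‖T x‖ ^ 2 := by
    simp only [hnorm]
    exact ⟨fun h x => h x.ofLp, fun h x => h (WithLp.toLp 2 x)⟩
  rw [key]
  constructor
  · intro h x
    -- In an eigenbasis of `T* T`, whose eigenvalues are the squared singular values, the inequality
    -- holds coordinate by coordinate.
    set b := hS.eigenvectorBasis hcard with hb
    rw [← hTx, ← b.sum_inner_mul_inner, ← real_inner_self_eq_norm_sq,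
      ← b.sum_inner_mul_inner, Finset.mul_sum]
    refine Finset.sum_le_sum fun m _ => ?_
    have h1 : inner ℝ ((T.adjoint ∘ₗ T) x) (b m) = hS.eigenvalues hcard m * inner ℝ x (b m) := by
      rw [hS x (b m), hb, hS.apply_eigenvectorBasis, inner_smul_right]
      simp
    rw [h1, ← T.sq_singularValues_fin hcard m, mul_assoc, real_inner_comm x (b m)]
    have := h m m.2
    refine mul_le_mul_of_nonneg_right ?_ (mul_self_nonneg _)
    gcongr
  · intro h m hm
    -- Conversely, testing on the `m`-th eigenvector isolates the `m`-th singular value.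
    have h1 := h (hS.eigenvectorBasis hcard ⟨m, hm⟩)
    rw [← hTx, hS.apply_eigenvectorBasis, inner_smul_left, real_inner_self_eq_norm_sq,
      (hS.eigenvectorBasis hcard).norm_eq_one, ← T.sq_singularValues_of_lt hcard hm] at h1
    simp only [one_pow, mul_one, RCLike.ofReal_real_eq_id, id, conj_trivial] at h1
    exact le_of_sq_le_sq h1 (T.singularValues_nonneg m)

theorem mem_inputMatrices_iff {ε : ℝ} (hε : 0 < ε) {B : SysMatrix n} :
    B ∈ inputMatrices n ε ↔
      IsBlockDiag B ∧ ∀ x, ε ^ 2 * (x ⬝ᵥ x) ≤ (B *ᵥ x) ⬝ᵥ (B *ᵥ x) := by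
  rw [← forall_le_singularValues_iff hε]
  rfl

/-- The vector `x` with the coordinates outside block `j` set to zero. -/
def blockPart (j : Fin q) (x : StateIdx n → ℝ) : StateIdx n → ℝ :=
  fun a => if a.1 = j then x a else 0

theorem IsBlockDiag.apply_eq_zero {M : SysMatrix n} (hM : IsBlockDiag M) {a b : StateIdx n}
    (h : a.1 ≠ b.1) : M a b = 0 :=
  hM a.1 b.1 h a.2 b.2

theorem IsBlockDiag.mulVec_blockPart {M : SysMatrix n} (hM : IsBlockDiag M) (j : Fin q)
    (x : StateIdx n → ℝ) : M *ᵥ blockPart j x = blockPart j (M *ᵥ x) := by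
  funext a
  simp only [Matrix.mulVec, dotProduct, blockPart]
  split_ifs with ha
  · refine Finset.sum_congr rfl fun b _ => ?_
    split_ifs with hb
    · rfl
    · rw [hM.apply_eq_zero (fun h => hb (h ▸ ha)), zero_mul, zero_mul]
  · refine Finset.sum_eq_zero fun b _ => ?_
    split_ifs with hb
    · rw [hM.apply_eq_zero (a := a) (b := b) (fun h => ha (h ▸ hb)), zero_mul]
    · rw [mul_zero]

/-- The matrix `B` with block row `j` replaced by that of `β I`. -/
def setInputBlock (B : SysMatrix n) (j : Fin q) (β : ℝ) : SysMatrix n :=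
  fun a b => if a.1 = j then (if a = b then β else 0) else B a b

theorem setInputBlock_mulVec_of_eq (B : SysMatrix n) {j : Fin q} (β : ℝ) (x : StateIdx n → ℝ)
    {a : StateIdx n} (ha : a.1 = j) : (setInputBlock B j β *ᵥ x) a = β * x a := by
  simp [Matrix.mulVec, dotProduct, setInputBlock, ha]

theorem setInputBlock_mulVec_of_ne (B : SysMatrix n) {j : Fin q} (β : ℝ) (x : StateIdx n → ℝ)
    {a : StateIdx n} (ha : a.1 ≠ j) : (setInputBlock B j β *ᵥ x) a = (B *ᵥ x) a := by
  simp [Matrix.mulVec, dotProduct, setInputBlock, ha]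

theorem IsBlockDiag.setInputBlock {B : SysMatrix n} (hB : IsBlockDiag B) (j : Fin q) (β : ℝ) :
    IsBlockDiag (setInputBlock B j β) := by
  intro i l hil k m
  have hne : (⟨i, k⟩ : StateIdx n) ≠ ⟨l, m⟩ := fun h => hil (congrArg Sigma.fst h)
  simp [LimitedModelInfo.setInputBlock, hne, hB i l hil k m]

/-- What the argument uses about the set of input matrices. -/
structure InputSet (𝓑 : Set (SysMatrix n)) (ε : ℝ) : Prop where
  blockDiag : ∀ B ∈ 𝓑, IsBlockDiag B
  isUnit : ∀ B ∈ 𝓑, IsUnit B.det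
  smul_one_mem : (ε • 1 : SysMatrix n) ∈ 𝓑
  setInputBlock_mem : ∀ B ∈ 𝓑, ∀ j β, ε ≤ β → setInputBlock B j β ∈ 𝓑

theorem inputSet_inputMatrices {ε : ℝ} (hε : 0 < ε) : InputSet (inputMatrices n ε) ε where
  blockDiag B hB := hB.1
  isUnit B hB := by
    rw [mem_inputMatrices_iff hε] at hB
    rw [← Matrix.isUnit_iff_isUnit_det, ← Matrix.mulVec_injective_iff_isUnit]
    intro x y hxy
    have h := hB.2 (x - y)
    have hz : B *ᵥ (x - y) = 0 := by rw [Matrix.mulVec_sub, sub_eq_zero]; exact hxy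
    rw [hz, zero_dotProduct] at h
    have h0 : (x - y) ⬝ᵥ (x - y) = 0 := by
      refine le_antisymm ?_ (Finset.sum_nonneg fun _ _ => mul_self_nonneg _)
      exact nonpos_of_mul_nonpos_right h (by positivity)
    exact sub_eq_zero.mp (dotProduct_self_eq_zero.mp h0)
  smul_one_mem := by
    rw [mem_inputMatrices_iff hε]
    constructor
    · intro i j hij k l
      have hne : (⟨i, k⟩ : StateIdx n) ≠ ⟨j, l⟩ := fun h => hij (congrArg Sigma.fst h)
      simp [hne]
    · intro x
      rw [Matrix.smul_mulVec, Matrix.one_mulVec, smul_dotProduct, dotProduct_smul]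
      simp only [smul_eq_mul]
      exact le_of_eq (by ring)
  setInputBlock_mem B hB j β hβ := by
    rw [mem_inputMatrices_iff hε] at hB ⊢
    refine ⟨hB.1.setInputBlock j β, fun x => ?_⟩
    -- Both squared norms split over blocks. This controls the blocks other than `j`; on block `j`
    -- the factor is `β ≥ ε`.
    have h := hB.2 (x - blockPart j x)
    rw [Matrix.mulVec_sub, hB.1.mulVec_blockPart] at h
    have h1 : ∀ y : StateIdx n → ℝ, (y - blockPart j y) ⬝ᵥ (y - blockPart j y) =
        ∑ a, if a.1 = j then 0 else y a * y a := by
      intro y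
      refine Finset.sum_congr rfl fun a _ => ?_
      by_cases ha : a.1 = j <;> simp [blockPart, ha]
    rw [h1, h1] at h
    have h2 : x ⬝ᵥ x =
        (∑ a, if a.1 = j then 0 else x a * x a) + ∑ a, if a.1 = j then x a * x a else 0 := by
      rw [← Finset.sum_add_distrib]
      refine Finset.sum_congr rfl fun a _ => ?_
      by_cases ha : a.1 = j <;> simp [ha]
    have h3 : (setInputBlock B j β *ᵥ x) ⬝ᵥ (setInputBlock B j β *ᵥ x) =
        (∑ a, if a.1 = j then 0 else (B *ᵥ x) a * (B *ᵥ x) a) +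
          β ^ 2 * ∑ a, if a.1 = j then x a * x a else 0 := by
      rw [Finset.mul_sum, ← Finset.sum_add_distrib]
      refine Finset.sum_congr rfl fun a _ => ?_
      by_cases ha : a.1 = j
      · simp only [setInputBlock_mulVec_of_eq B β x ha, ha, if_true]; ring
      · simp only [setInputBlock_mulVec_of_ne B β x ha, ha, if_false]; ring
    rw [h2, h3, mul_add]
    refine add_le_add h (mul_le_mul_of_nonneg_right (by gcongr) ?_)
    refine Finset.sum_nonneg fun a _ => ?_
    split_ifs
    exacts [mul_self_nonneg _, le_rfl]

theorem inputSet_diagInputMatrices {ε : ℝ} (hε : 0 < ε) : InputSet (diagInputMatrices n ε) ε where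
  blockDiag B hB i j hij k l := hB.1 fun h => hij (congrArg Sigma.fst h)
  isUnit B hB := by
    rw [← hB.1.diagonal_diag, Matrix.det_diagonal, isUnit_iff_ne_zero]
    exact Finset.prod_ne_zero_iff.mpr fun a _ => (hε.trans_le (hB.2 a)).ne'
  smul_one_mem := by
    refine ⟨fun a b hab => ?_, fun a => ?_⟩
    · simp [hab]
    · simp
  setInputBlock_mem B hB j β hβ := by
    refine ⟨fun a b hab => ?_, fun a => ?_⟩
    · simp [setInputBlock, hab, hB.1 hab]
    · by_cases ha : a.1 = j
      · simpa [setInputBlock, ha] using hβ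
      · simpa [setInputBlock, ha] using hB.2 a

/-- An invertible block-diagonal matrix is injective on each block separately. -/
theorem IsBlockDiag.eq_zero_of_mulVec_eq_zero {B : SysMatrix n} (hB : IsBlockDiag B)
    (hu : IsUnit B.det) {i : Fin q} {x : StateIdx n → ℝ}
    (h : ∀ k, (B *ᵥ x) ⟨i, k⟩ = 0) (k : Fin (n i)) : x ⟨i, k⟩ = 0 := by
  have hz : B *ᵥ blockPart i x = 0 := by
    rw [hB.mulVec_blockPart]
    funext ⟨l, m⟩
    by_cases hl : l = i
    · subst hl; simp [blockPart, h]
    · simp [blockPart, hl]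
  have hinj := Matrix.mulVec_injective_iff_isUnit.mpr ((Matrix.isUnit_iff_isUnit_det B).mpr hu)
  have h0 : blockPart i x = 0 := hinj (by simpa using hz)
  simpa [blockPart] using congrFun h0 ⟨i, k⟩

/-- Row block `i` of a block-diagonal matrix acts through block `i` of the vector. -/
theorem IsBlockDiag.mulVec_apply {M : SysMatrix n} (hM : IsBlockDiag M) (x : StateIdx n → ℝ)
    (i : Fin q) (k : Fin (n i)) :
    (M *ᵥ x) ⟨i, k⟩ = ∑ l, M ⟨i, k⟩ ⟨i, l⟩ * x ⟨i, l⟩ := by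
  simp only [Matrix.mulVec, dotProduct]
  rw [Fintype.sum_sigma, Finset.sum_eq_single i]
  · intro j _ hj
    exact Finset.sum_eq_zero fun l _ => by rw [hM i j hj.symm, zero_mul]
  · simp

end InputMatrices

/-! ### Quadratic costs and the deadbeat method. -/

section Cost

variable {q : ℕ} {n : Fin q → ℕ} {GP GK : Digraph (Fin q)} {𝓑 : Set (SysMatrix n)} {ε : ℝ}

theorem quadratic_nonneg {ι : Type*} [Fintype ι] {M : Matrix ι ι ℝ} (hM : M.PosDef) (x : ι → ℝ) :
    0 ≤ x ⬝ᵥ (M *ᵥ x) := by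
  simpa using hM.posSemidef.dotProduct_mulVec_nonneg x

theorem dotProduct_mulVec_comm {ι : Type*} [Fintype ι] {M : Matrix ι ι ℝ} (hM : M.PosDef)
    (x y : ι → ℝ) : x ⬝ᵥ (M *ᵥ y) = y ⬝ᵥ (M *ᵥ x) := by
  have h : Mᵀ = M := by simpa using hM.isHermitian.eq
  rw [Matrix.dotProduct_mulVec, ← Matrix.mulVec_transpose, h, dotProduct_comm]

/-- A convex quadratic form lies above its tangents. -/
theorem tangent_le_quadratic {ι : Type*} [Fintype ι] {M : Matrix ι ι ℝ} (hM : M.PosDef)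
    (x y : ι → ℝ) : 2 * (x ⬝ᵥ (M *ᵥ y)) - y ⬝ᵥ (M *ᵥ y) ≤ x ⬝ᵥ (M *ᵥ x) := by
  have h := quadratic_nonneg hM (x - y)
  rw [Matrix.mulVec_sub, sub_dotProduct, dotProduct_sub, dotProduct_sub,
    dotProduct_mulVec_comm hM y x] at h
  linarith

theorem quadratic_add_smul {ι : Type*} [Fintype ι] {M : Matrix ι ι ℝ} (hM : M.PosDef)
    (x y : ι → ℝ) (t : ℝ) : (x + t • y) ⬝ᵥ (M *ᵥ (x + t • y)) =
      x ⬝ᵥ (M *ᵥ x) + 2 * t * (x ⬝ᵥ (M *ᵥ y)) + t ^ 2 * (y ⬝ᵥ (M *ᵥ y)) := by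
  simp only [Matrix.mulVec_add, Matrix.mulVec_smul, add_dotProduct, dotProduct_add,
    smul_dotProduct, dotProduct_smul, smul_eq_mul, dotProduct_mulVec_comm hM y x]
  ring

/-- The cost of a trajectory that reaches the origin in two steps with `u(1) = 0`. -/
theorem cost_of_state_two_eq_zero {Q R : SysMatrix n} (hQ : Q.PosDef) (hR : R.PosDef)
    (P : Plant n GP 𝓑) (K : SysMatrix n)
    (hu : P.input K 1 = 0) (hx : P.state K 2 = 0) :
    cost Q R P K = ENNReal.ofReal (P.state K 1 ⬝ᵥ (Q *ᵥ P.state K 1) +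
      P.input K 0 ⬝ᵥ (R *ᵥ P.input K 0)) := by
  have hs : ∀ k, P.state K (k + 2) = 0 := by
    intro k
    induction k with
    | zero => exact hx
    | succ k ih => rw [Plant.state, ih]; simp
  have hin : ∀ k, k ≠ 0 → P.input K k = 0 := by
    intro k hk
    match k, hk with
    | 1, _ => exact hu
    | k + 2, _ => rw [Plant.input, hs]; simp
  rw [ENNReal.ofReal_add (quadratic_nonneg hQ _) (quadratic_nonneg hR _), cost]
  congr 1
  · rw [tsum_eq_single 0]
    intro k hk
    obtain ⟨m, rfl⟩ := Nat.exists_eq_succ_of_ne_zero hk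
    simp [hs]
  · rw [tsum_eq_single 0]
    intro k hk
    simp [hin k hk]

/-- The terms of the first two steps bound the cost from below. -/
theorem le_cost {Q R : SysMatrix n} (hQ : Q.PosDef) (hR : R.PosDef) (P : Plant n GP 𝓑)
    (K : SysMatrix n) :
    ENNReal.ofReal ((P.state K 1 ⬝ᵥ (Q *ᵥ P.state K 1) + P.input K 0 ⬝ᵥ (R *ᵥ P.input K 0)) +
      (P.state K 2 ⬝ᵥ (Q *ᵥ P.state K 2) + P.input K 1 ⬝ᵥ (R *ᵥ P.input K 1))) ≤
      cost Q R P K := by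
  have hq := quadratic_nonneg hQ
  have hr := quadratic_nonneg hR
  rw [add_add_add_comm, ENNReal.ofReal_add (add_nonneg (hq _) (hq _)) (add_nonneg (hr _) (hr _)),
    ENNReal.ofReal_add (hq _) (hq _), ENNReal.ofReal_add (hr _) (hr _), cost]
  refine add_le_add ?_ ?_
  · simpa [Finset.sum_range_succ] using ENNReal.sum_le_tsum
      (f := fun k => ENNReal.ofReal (P.state K (k + 1) ⬝ᵥ (Q *ᵥ P.state K (k + 1))))
      (Finset.range 2)
  · simpa [Finset.sum_range_succ] using ENNReal.sum_le_tsum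
      (f := fun k => ENNReal.ofReal (P.input K k ⬝ᵥ (R *ᵥ P.input K k))) (Finset.range 2)

theorem InputSet.mulVec_deadbeat (h𝓑 : InputSet 𝓑 ε) (P : Plant n GP 𝓑) (x : StateIdx n → ℝ) :
    P.B *ᵥ (deadbeat P *ᵥ x) = -(P.A *ᵥ x) := by
  rw [deadbeat, Matrix.mulVec_mulVec, Matrix.mul_neg,
    Matrix.mul_nonsing_inv_cancel_left _ _ (h𝓑.isUnit _ P.B_mem), Matrix.neg_mulVec]

theorem InputSet.deadbeat_mulVec_eq (h𝓑 : InputSet 𝓑 ε) (P : Plant n GP 𝓑)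
    {x u : StateIdx n → ℝ} (h : P.B *ᵥ u = -(P.A *ᵥ x)) : deadbeat P *ᵥ x = u := by
  refine Matrix.mulVec_injective_iff_isUnit.mpr
    ((Matrix.isUnit_iff_isUnit_det _).mpr (h𝓑.isUnit _ P.B_mem)) ?_
  rw [h𝓑.mulVec_deadbeat, h]

theorem InputSet.cost_deadbeat (h𝓑 : InputSet 𝓑 ε) {Q R : SysMatrix n} (hQ : Q.PosDef)
    (hR : R.PosDef) (P : Plant n GP 𝓑) :
    cost Q R P (deadbeat P) = ENNReal.ofReal
      ((deadbeat P *ᵥ P.x₀) ⬝ᵥ (R *ᵥ (deadbeat P *ᵥ P.x₀))) := by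
  have h1 : P.state (deadbeat P) 1 = 0 := by
    simp [Plant.state, h𝓑.mulVec_deadbeat]
  rw [cost_of_state_two_eq_zero hQ hR P _ (by rw [Plant.input, h1]; simp)
    (by rw [Plant.state, h1]; simp), h1]
  simp [Plant.input, Plant.state]

/-- Since `B` is injective on each block, block row `i` of `-B⁻¹A` is the unique solution of a
linear system involving only `B_ii` and block row `i` of `A`. Locality and sparsity both follow,
column by column. -/
theorem InputSet.deadbeat_mem (h𝓑 : InputSet 𝓑 ε) (hGK : GP ≤ GK) :
    (deadbeat : Plant n GP 𝓑 → SysMatrix n) ∈ designMethods n GP GK (selfLoopGraph q) 𝓑 := by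
  have hcol : ∀ (P : Plant n GP 𝓑) (b a : StateIdx n),
      deadbeat P a b = (deadbeat P *ᵥ Pi.single b 1) a := by simp
  have hB := fun P : Plant n GP 𝓑 => h𝓑.blockDiag _ P.B_mem
  have hU := fun P : Plant n GP 𝓑 => h𝓑.isUnit _ P.B_mem
  constructor
  · intro P i j hij k l
    rw [hcol]
    refine (hB P).eq_zero_of_mulVec_eq_zero (hU P) (fun m => ?_) k
    rw [h𝓑.mulVec_deadbeat]
    simpa using P.A_mem i j (fun h => hij (hGK h)) m l
  · intro i P P' h k b
    obtain ⟨hA, hBB⟩ := h i rfl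
    rw [hcol, hcol, ← sub_eq_zero, ← Pi.sub_apply]
    refine (hB P).eq_zero_of_mulVec_eq_zero (hU P) (fun m => ?_) k
    have h2 : (P.B *ᵥ (deadbeat P' *ᵥ Pi.single b 1)) ⟨i, m⟩ =
        (P'.B *ᵥ (deadbeat P' *ᵥ Pi.single b 1)) ⟨i, m⟩ := by
      rw [(hB P).mulVec_apply, (hB P').mulVec_apply]
      simp only [hBB]
    rw [Matrix.mulVec_sub, Pi.sub_apply, h2, h𝓑.mulVec_deadbeat, h𝓑.mulVec_deadbeat]
    simp [hA]

end Cost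

/-! ### A non-isolated sink: deadbeat is dominated. -/

section Sink

variable {q : ℕ} {n : Fin q → ℕ} {GP GK : Digraph (Fin q)} {𝓑 : Set (SysMatrix n)} {ε : ℝ}

theorem Plant.A_apply_eq_zero (P : Plant n GP 𝓑) {a b : StateIdx n} (h : ¬ GP.Adj b.1 a.1) :
    P.A a b = 0 :=
  P.A_mem a.1 b.1 h a.2 b.2

/-- Column `a` of `M` is supported in block `a.1`. With `M = R` this removes the cross terms between
subsystems. -/
theorem IsBlockDiag.dotProduct_mulVec_single {M : SysMatrix n} (hM : IsBlockDiag M)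
    {x : StateIdx n → ℝ} {a : StateIdx n} (hx : ∀ k, x ⟨a.1, k⟩ = 0) :
    x ⬝ᵥ (M *ᵥ Pi.single a 1) = 0 := by
  refine Finset.sum_eq_zero fun b _ => ?_
  obtain ⟨i, k⟩ := b
  rw [Matrix.mulVec_single_one, Matrix.col_apply]
  by_cases hi : i = a.1
  · subst hi; rw [hx, zero_mul]
  · rw [hM.apply_eq_zero hi, mul_zero]

/-- Subsystem `a.1` of the plant `P` has the input block `ε I`, and it is driven by the single
state coordinate `b`, which acts on the coordinate `a` with gain one. -/
def IsDrivenBy (ε : ℝ) (a b : StateIdx n) (P : Plant n GP 𝓑) : Prop :=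
  (∀ k c, P.A ⟨a.1, k⟩ c = if (⟨a.1, k⟩ : StateIdx n) = a ∧ c = b then 1 else 0) ∧
    ∀ k l, P.B ⟨a.1, k⟩ ⟨a.1, l⟩ = if k = l then ε else 0

open Classical in
/-- The deadbeat method, except that subsystem `a.1` reduces its gain by the factor `1 - δ`
when it is of the form described by `IsDrivenBy`. -/
noncomputable def relaxedDeadbeat (ε δ : ℝ) (a b : StateIdx n) (P : Plant n GP 𝓑) : SysMatrix n :=
  fun c d => (if c.1 = a.1 ∧ IsDrivenBy ε a b P then 1 - δ else 1) * deadbeat P c d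

theorem IsDrivenBy.congr {a b : StateIdx n} {P P' : Plant n GP 𝓑} (h : SameModel a.1 P P')
    (hP : IsDrivenBy ε a b P) : IsDrivenBy ε a b P' :=
  ⟨fun k c => by rw [← h.1, hP.1], fun k l => by rw [← h.2, hP.2]⟩

theorem SameModel.symm {j : Fin q} {P P' : Plant n GP 𝓑} (h : SameModel j P P') :
    SameModel j P' P :=
  ⟨fun k c => (h.1 k c).symm, fun k l => (h.2 k l).symm⟩

/-- The switch `IsDrivenBy` affects only block row `a.1` and reads only the model of that subsystem,
so locality survives. -/
theorem InputSet.relaxedDeadbeat_mem (h𝓑 : InputSet 𝓑 ε) (hGK : GP ≤ GK) (δ : ℝ)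
    (a b : StateIdx n) :
    (relaxedDeadbeat ε δ a b : Plant n GP 𝓑 → SysMatrix n) ∈
      designMethods n GP GK (selfLoopGraph q) 𝓑 := by
  have hd := h𝓑.deadbeat_mem (GK := GK) hGK
  refine ⟨fun P i j hij k l => ?_, fun i P P' h k c => ?_⟩
  · rw [relaxedDeadbeat, hd.1 P i j hij k l, mul_zero]
  · have hm := h i rfl
    rw [relaxedDeadbeat, relaxedDeadbeat, hd.2 i P P' h k c]
    congr 2
    refine propext (and_congr_right fun hi => ?_)
    obtain rfl : i = a.1 := hi
    exact ⟨fun hP => hP.congr hm, fun hP => hP.congr hm.symm⟩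

theorem relaxedDeadbeat_of_not {δ : ℝ} {a b : StateIdx n} {P : Plant n GP 𝓑}
    (h : ¬ IsDrivenBy ε a b P) : relaxedDeadbeat ε δ a b P = deadbeat P := by
  funext c d
  simp [relaxedDeadbeat, h]

/-- On a sink that is driven by one coordinate of another subsystem, reducing the deadbeat gain
changes the cost by an explicit amount. -/
theorem InputSet.cost_relaxedDeadbeat (h𝓑 : InputSet 𝓑 ε) (hε : 0 < ε) {Q R : SysMatrix n}
    (hQ : Q.PosDef) (hR : R.PosDef) (hRd : IsBlockDiag R) (δ : ℝ) {a b : StateIdx n}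
    (hsink : IsSink GP a.1) (hab : a.1 ≠ b.1) {P : Plant n GP 𝓑} (hP : IsDrivenBy ε a b P) :
    cost Q R P (relaxedDeadbeat ε δ a b P) = ENNReal.ofReal
      ((deadbeat P *ᵥ P.x₀) ⬝ᵥ (R *ᵥ (deadbeat P *ᵥ P.x₀)) +
        P.x₀ b ^ 2 * (δ ^ 2 * Q a a + (δ ^ 2 - 2 * δ) * ε⁻¹ ^ 2 * R a a)) := by
  set K := relaxedDeadbeat ε δ a b P with hK
  set e : StateIdx n → ℝ := Pi.single a 1 with he
  have hBd := h𝓑.blockDiag _ P.B_mem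
  have hu := h𝓑.isUnit _ P.B_mem
  have hdb := fun x => h𝓑.mulVec_deadbeat P x
  have hApp : ∀ x k, (P.A *ᵥ x) ⟨a.1, k⟩ = if (⟨a.1, k⟩ : StateIdx n) = a then x b else 0 := by
    intro x k
    simp only [Matrix.mulVec, dotProduct, hP.1]
    by_cases h : (⟨a.1, k⟩ : StateIdx n) = a <;> simp [h]
  have hBpp : ∀ x k, (P.B *ᵥ x) ⟨a.1, k⟩ = ε * x ⟨a.1, k⟩ := by
    intro x k
    rw [hBd.mulVec_apply]
    simp [hP.2]
  have hdpp : ∀ x k, (deadbeat P *ᵥ x) ⟨a.1, k⟩ =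
      if (⟨a.1, k⟩ : StateIdx n) = a then -(ε⁻¹ * x b) else 0 := by
    intro x k
    have h := congrFun (hdb x) ⟨a.1, k⟩
    rw [hBpp, Pi.neg_apply, hApp] at h
    split_ifs with hk <;> simp only [hk, if_true, if_false] at h
    · rw [hk]; field_simp; linarith
    · simpa [hε.ne'] using h
  have hKx : ∀ x, K *ᵥ x = deadbeat P *ᵥ x + (δ * ε⁻¹ * x b) • e := by
    intro x
    have h0 : ∀ c, (K *ᵥ x) c = (if c.1 = a.1 then 1 - δ else 1) * (deadbeat P *ᵥ x) c := by
      intro c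
      simp only [Matrix.mulVec, dotProduct, hK, relaxedDeadbeat, hP, and_true, Finset.mul_sum,
        mul_assoc]
    funext ⟨i, k⟩
    rw [h0]
    by_cases hi : i = a.1
    · subst hi
      simp only [if_true, Pi.add_apply, hdpp, Pi.smul_apply, he, smul_eq_mul]
      by_cases hk : (⟨a.1, k⟩ : StateIdx n) = a
      · simp only [hk, if_true, Pi.single_eq_same]; ring
      · simp [hk]
    · have hne : (⟨i, k⟩ : StateIdx n) ≠ a := fun h => hi (congrArg Sigma.fst h)
      simp [hi, he, hne]
  have hBe : P.B *ᵥ e = ε • e := by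
    funext ⟨i, k⟩
    by_cases hi : i = a.1
    · subst hi; rw [hBpp]; rfl
    · have hne : (⟨i, k⟩ : StateIdx n) ≠ a := fun h => hi (congrArg Sigma.fst h)
      simp [he, hne, hBd.apply_eq_zero (a := ⟨i, k⟩) (b := a) hi]
  -- Other subsystems do not see `a` because `a.1` is a sink; its own rows do not because their only
  -- nonzero entry is in column `b ≠ a`.
  have hAe : P.A *ᵥ e = 0 := by
    funext ⟨i, k⟩
    by_cases hi : i = a.1
    · subst hi
      have hba : b ≠ a := fun h => hab (h ▸ rfl)
      rw [hApp]
      simp [he, hba]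
    · simpa [he] using P.A_apply_eq_zero (a := ⟨i, k⟩) (b := a) (hsink i hi)
  have heb : e b = 0 := Pi.single_eq_of_ne (fun h => hab (congrArg Sigma.fst h).symm) _
  have hKe : K *ᵥ e = 0 := by
    rw [hKx, heb, mul_zero, zero_smul, add_zero]
    exact h𝓑.deadbeat_mulVec_eq P (by simp [hAe])
  have h0 : P.input K 0 = deadbeat P *ᵥ P.x₀ + (δ * ε⁻¹ * P.x₀ b) • e := hKx _
  have h1 : P.state K 1 = (δ * P.x₀ b) • e := by
    have : P.state K 1 = P.A *ᵥ P.x₀ + P.B *ᵥ (K *ᵥ P.x₀) := rfl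
    rw [this, hKx, Matrix.mulVec_add, hdb, Matrix.mulVec_smul, hBe, add_neg_cancel_left, smul_smul]
    congr 1
    field_simp
  have h2 : P.input K 1 = 0 := by
    rw [Plant.input, h1, Matrix.mulVec_smul, hKe, smul_zero]
  have h3 : P.state K 2 = 0 := by
    have : P.state K 2 = P.A *ᵥ P.state K 1 + P.B *ᵥ P.input K 1 := rfl
    rw [this, h2, h1, Matrix.mulVec_smul, hAe]
    simp
  have heM : ∀ M : SysMatrix n, e ⬝ᵥ (M *ᵥ e) = M a a := by
    intro M; simp [he]
  -- Inside block `a.1` the deadbeat input is `-ε⁻¹ x₀(b) e`, so correcting by this vector makes the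
  -- block vanish.
  have hcross : (deadbeat P *ᵥ P.x₀) ⬝ᵥ (R *ᵥ e) = -(ε⁻¹ * P.x₀ b) * R a a := by
    have hz := hRd.dotProduct_mulVec_single (a := a)
      (x := deadbeat P *ᵥ P.x₀ + (ε⁻¹ * P.x₀ b) • e) (fun k => by
        rw [Pi.add_apply, hdpp]
        by_cases hk : (⟨a.1, k⟩ : StateIdx n) = a <;> simp [hk, he])
    rw [← he, add_dotProduct, smul_dotProduct, heM, smul_eq_mul] at hz
    linarith
  rw [cost_of_state_two_eq_zero hQ hR P K h2 h3, h0, h1, quadratic_add_smul hR,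
    Matrix.mulVec_smul, smul_dotProduct, dotProduct_smul, heM, heM, hcross]
  congr 1
  simp only [smul_eq_mul]
  ring

/-- If the plant graph has a sink that is not isolated, then the deadbeat method is dominated. -/
theorem InputSet.exists_dominates_of_isSink (h𝓑 : InputSet 𝓑 ε) (hε : 0 < ε)
    (hn : ∀ i, 1 ≤ n i) (hGK : GP ≤ GK) {Q R : SysMatrix n} (hQ : Q.PosDef) (hR : R.PosDef)
    (hRd : IsBlockDiag R) {i : Fin q} (hi : IsSink GP i) (hiso : ¬ IsIsolated GP i) :
    ∃ Γ ∈ designMethods n GP GK (selfLoopGraph q) 𝓑,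
      Dominates Q R Γ (deadbeat : Plant n GP 𝓑 → SysMatrix n) := by
  obtain ⟨j, hji, hadj⟩ : ∃ j, j ≠ i ∧ GP.Adj j i := by
    by_contra! h
    exact hiso fun j hj => ⟨hi j hj, h j hj⟩
  set a : StateIdx n := ⟨i, ⟨0, hn i⟩⟩ with ha
  set b : StateIdx n := ⟨j, ⟨0, hn j⟩⟩ with hb
  have hab : a.1 ≠ b.1 := hji.symm
  have hQa := hQ.diag_pos (i := a)
  have hRa : 0 < ε⁻¹ ^ 2 * R a a := mul_pos (by positivity) (hR.diag_pos (i := a))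
  set ρ := ε⁻¹ ^ 2 * R a a with hρ
  -- The minimiser of the cost change `δ² (Q a a + ρ) - 2 δ ρ`, where it equals `-δ ρ`.
  set δ := ρ / (Q a a + ρ) with hδ
  have hδ0 : 0 < δ := by positivity
  have hgain : δ ^ 2 * Q a a + (δ ^ 2 - 2 * δ) * ε⁻¹ ^ 2 * R a a < 0 := by
    have h1 : δ * (Q a a + ρ) = ρ := by rw [hδ]; field_simp
    have h2 : δ ^ 2 * Q a a + (δ ^ 2 - 2 * δ) * ε⁻¹ ^ 2 * R a a =
        δ * (δ * (Q a a + ρ)) - 2 * δ * ρ := by rw [hρ]; ring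
    rw [h2, h1]
    nlinarith
  refine ⟨relaxedDeadbeat ε δ a b, h𝓑.relaxedDeadbeat_mem hGK δ a b, fun P => ?_, ?_⟩
  · by_cases hP : IsDrivenBy ε a b P
    · rw [h𝓑.cost_relaxedDeadbeat hε hQ hR hRd δ hi hab hP, h𝓑.cost_deadbeat hQ hR]
      refine ENNReal.ofReal_le_ofReal ?_
      have := mul_nonpos_of_nonneg_of_nonpos (sq_nonneg (P.x₀ b)) hgain.le
      linarith
    · rw [relaxedDeadbeat_of_not hP]
  · let P : Plant n GP 𝓑 :=
      { A := Matrix.single a b 1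
        B := ε • 1
        x₀ := Pi.single b 1
        A_mem := by
          intro i' j' hij k l
          rw [Matrix.single_apply]
          refine if_neg fun h => hij ?_
          obtain rfl : a.1 = i' := congrArg Sigma.fst h.1
          obtain rfl : b.1 = j' := congrArg Sigma.fst h.2
          exact hadj
        B_mem := h𝓑.smul_one_mem }
    have hP : IsDrivenBy ε a b P := by
      refine ⟨fun k c => ?_, fun k l => ?_⟩
      · simp only [P, Matrix.single_apply, eq_comm]
      · simp [P, Matrix.one_apply]
    have hub : (deadbeat P *ᵥ P.x₀) = -ε⁻¹ • Pi.single a 1 := by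
      apply h𝓑.deadbeat_mulVec_eq
      simp only [P, Matrix.smul_mulVec, Matrix.one_mulVec, smul_smul]
      funext c
      by_cases hc : a = c <;> simp [hε.ne', hc]
    have hpos : 0 < (deadbeat P *ᵥ P.x₀) ⬝ᵥ (R *ᵥ (deadbeat P *ᵥ P.x₀)) := by
      rw [hub, Matrix.mulVec_smul, smul_dotProduct, dotProduct_smul]
      have : (Pi.single a 1 : StateIdx n → ℝ) ⬝ᵥ (R *ᵥ Pi.single a 1) = R a a := by simp
      rw [this]
      simp only [smul_eq_mul]
      calc (0 : ℝ) < ρ := hRa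
        _ = _ := by rw [hρ]; ring
    refine ⟨P, ?_⟩
    rw [h𝓑.cost_relaxedDeadbeat hε hQ hR hRd δ hi hab hP, h𝓑.cost_deadbeat hQ hR]
    refine (ENNReal.ofReal_lt_ofReal_iff hpos).mpr ?_
    have : P.x₀ b = 1 := by simp [P]
    rw [this]
    linarith

end Sink

/-! ### No sink: deadbeat is undominated. -/

section NoSink

variable {q : ℕ} {n : Fin q → ℕ} {GP GK : Digraph (Fin q)} {𝓑 : Set (SysMatrix n)} {ε : ℝ}

/-- The matrix `A` with block row `b.1` replaced by the single entry `r` at position `(b, a)`. -/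
def setDriver (A : SysMatrix n) (b a : StateIdx n) (r : ℝ) : SysMatrix n :=
  fun c d => if c.1 = b.1 then Matrix.single b a r c d else A c d

theorem setDriver_mulVec_of_eq (A : SysMatrix n) (b a : StateIdx n) (r : ℝ) (x : StateIdx n → ℝ)
    {c : StateIdx n} (hc : c.1 = b.1) :
    (setDriver A b a r *ᵥ x) c = (r * x a) * (Pi.single b 1 : StateIdx n → ℝ) c := by
  simp only [Matrix.mulVec, dotProduct, setDriver, hc, if_true, Matrix.single_apply]
  by_cases h : b = c
  · subst h; simp
  · simp [h, Ne.symm h]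

theorem setDriver_mulVec_of_ne (A : SysMatrix n) (b a : StateIdx n) (r : ℝ) (x : StateIdx n → ℝ)
    {c : StateIdx n} (hc : c.1 ≠ b.1) : (setDriver A b a r *ᵥ x) c = (A *ᵥ x) c := by
  simp [Matrix.mulVec, dotProduct, setDriver, hc]

/-- The plant obtained from `P` by giving subsystem `b.1` the input block `β I` and driving it by
the coordinate `a` with gain `r`, started at `x₀`. -/
def InputSet.drivenPlant (h𝓑 : InputSet 𝓑 ε) (P : Plant n GP 𝓑) {b a : StateIdx n}
    (hadj : GP.Adj a.1 b.1) {β : ℝ} (hβ : ε ≤ β) (r : ℝ) (x₀ : StateIdx n → ℝ) :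
    Plant n GP 𝓑 where
  A := setDriver P.A b a r
  B := setInputBlock P.B b.1 β
  x₀ := x₀
  A_mem := by
    intro i j hij k l
    by_cases hi : i = b.1
    · simp only [setDriver, hi, if_true, Matrix.single_apply]
      refine if_neg fun h => hij ?_
      obtain rfl : b.1 = i := congrArg Sigma.fst h.1
      obtain rfl : a.1 = j := congrArg Sigma.fst h.2
      exact hadj
    · simpa [setDriver, hi] using P.A_mem i j hij k l
  B_mem := h𝓑.setInputBlock_mem _ P.B_mem _ _ hβ

theorem InputSet.sameModel_drivenPlant (h𝓑 : InputSet 𝓑 ε) (P : Plant n GP 𝓑) {b a : StateIdx n}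
    (hadj : GP.Adj a.1 b.1) {β : ℝ} (hβ : ε ≤ β) (r : ℝ) (x₀ : StateIdx n → ℝ) {i : Fin q}
    (hi : i ≠ b.1) : SameModel i P (h𝓑.drivenPlant P hadj hβ r x₀) :=
  ⟨fun k c => by simp [drivenPlant, setDriver, hi],
    fun k l => by simp [drivenPlant, setInputBlock, hi]⟩

/-- The deadbeat cost of `drivenPlant`: only the input of the driven subsystem depends on the
gain. -/
theorem InputSet.exists_cost_deadbeat_drivenPlant (h𝓑 : InputSet 𝓑 ε) (hε : 0 < ε)
    {Q R : SysMatrix n} (hQ : Q.PosDef) (hR : R.PosDef) (hRd : IsBlockDiag R)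
    (P : Plant n GP 𝓑) {b a : StateIdx n} (hadj : GP.Adj a.1 b.1) (x₀ : StateIdx n → ℝ) :
    ∃ C : ℝ, ∀ (β : ℝ) (hβ : ε ≤ β) (r : ℝ),
      cost Q R (h𝓑.drivenPlant P hadj hβ r x₀) (deadbeat (h𝓑.drivenPlant P hadj hβ r x₀)) =
        ENNReal.ofReal (C + (r * x₀ a / β) ^ 2 * R b b) := by
  -- The deadbeat input outside block `b.1` ignores the modified model, so its cost is a constant
  -- `C` free of `β` and `r`.
  set u := deadbeat P *ᵥ x₀ - blockPart b.1 (deadbeat P *ᵥ x₀) with hu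
  refine ⟨u ⬝ᵥ (R *ᵥ u), fun β hβ r => ?_⟩
  have hβ0 : β ≠ 0 := (hε.trans_le hβ).ne'
  set P' := h𝓑.drivenPlant P hadj hβ r x₀ with hP'
  have hub : ∀ c : StateIdx n, c.1 = b.1 → u c = 0 := by
    intro c hc; simp [hu, blockPart, hc]
  have hd : deadbeat P' *ᵥ P'.x₀ = u + (-(r * x₀ a / β)) • Pi.single b 1 := by
    apply h𝓑.deadbeat_mulVec_eq
    funext c
    by_cases hc : c.1 = b.1
    · have h1 : (P'.A *ᵥ P'.x₀) c = _ := setDriver_mulVec_of_eq P.A b a r x₀ hc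
      have h2 : (P'.B *ᵥ (u + (-(r * x₀ a / β)) • Pi.single b 1)) c = _ :=
        setInputBlock_mulVec_of_eq P.B β _ hc
      rw [Pi.neg_apply, h1, h2, Pi.add_apply, hub c hc, Pi.smul_apply, smul_eq_mul]
      field_simp
      ring
    · have h1 : (P'.A *ᵥ P'.x₀) c = _ := setDriver_mulVec_of_ne P.A b a r x₀ hc
      have h2 : (P'.B *ᵥ (u + (-(r * x₀ a / β)) • Pi.single b 1)) c = _ :=
        setInputBlock_mulVec_of_ne P.B β _ hc
      have hBd := h𝓑.blockDiag _ P.B_mem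
      rw [Pi.neg_apply, h1, h2, hu, Matrix.mulVec_add, Matrix.mulVec_sub, hBd.mulVec_blockPart,
        h𝓑.mulVec_deadbeat, Matrix.mulVec_smul]
      simp [blockPart, hc, hBd.apply_eq_zero hc]
  rw [h𝓑.cost_deadbeat hQ hR, hd, quadratic_add_smul hR,
    hRd.dotProduct_mulVec_single (fun k => hub _ rfl)]
  congr 1
  simp

/-- Lower bound for one step `x' = v + β u` of the driven subsystem. -/
theorem step_cost_lower_bound {Q R : SysMatrix n} (hQ : Q.PosDef) (hR : R.PosDef)
    (hRd : IsBlockDiag R) {b : StateIdx n} {β : ℝ} (hβ : 0 < β) (s : ℝ)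
    {x u : StateIdx n → ℝ}
    (hx : ∀ c : StateIdx n, c.1 = b.1 →
      x c = s * (Pi.single b 1 : StateIdx n → ℝ) c + β * u c) :
    (s / β) ^ 2 * (R b b - (R.col b ⬝ᵥ (Q⁻¹ *ᵥ R.col b)) / β ^ 2) ≤
      x ⬝ᵥ (Q *ᵥ x) + u ⬝ᵥ (R *ᵥ u) := by
  set e : StateIdx n → ℝ := Pi.single b 1 with he
  have hcol : R *ᵥ e = R.col b := by rw [he, Matrix.mulVec_single_one]
  have hdet : IsUnit Q.det := (Matrix.isUnit_iff_isUnit_det _).mp hQ.isUnit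
  have hQz : Q *ᵥ (Q⁻¹ *ᵥ R.col b) = R.col b := by
    rw [Matrix.mulVec_mulVec, Matrix.mul_nonsing_inv _ hdet, Matrix.one_mulVec]
  -- The two tangent points are chosen so that the terms linear in `u` cancel once `x` is eliminated
  -- through `h3`.
  have h1 := tangent_le_quadratic hQ x ((s / β ^ 2) • (Q⁻¹ *ᵥ R.col b))
  have h2 := tangent_le_quadratic hR u ((-(s / β)) • e)
  have h3 : x ⬝ᵥ R.col b = s * R b b + β * (u ⬝ᵥ R.col b) := by
    have hz := hRd.dotProduct_mulVec_single (a := b) (x := x - s • e - β • u) (fun k => by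
      simp [hx ⟨b.1, k⟩ rfl])
    rw [← he, hcol, sub_dotProduct, sub_dotProduct, smul_dotProduct, smul_dotProduct] at hz
    have : e ⬝ᵥ R.col b = R b b := by simp [he]
    simp only [this, smul_eq_mul] at hz
    linarith
  have h4 : e ⬝ᵥ R.col b = R b b := by simp [he]
  simp only [Matrix.mulVec_smul, hQz, hcol, dotProduct_smul, smul_dotProduct, smul_eq_mul, h3,
    h4, dotProduct_comm (Q⁻¹ *ᵥ R.col b)] at h1 h2
  refine le_trans (le_of_eq ?_) (add_le_add h1 h2)
  field_simp
  ring

/-- A method whose closed-loop matrix `A + B Γ(P)` is nonzero in a row of a subsystem with an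
outgoing edge has a larger cost than the deadbeat method for some plant. -/
theorem InputSet.exists_cost_deadbeat_lt (h𝓑 : InputSet 𝓑 ε) (hε : 0 < ε)
    {Q R : SysMatrix n} (hQ : Q.PosDef) (hR : R.PosDef) (hRd : IsBlockDiag R)
    {Γ : Plant n GP 𝓑 → SysMatrix n} (hΓ : Γ ∈ designMethods n GP GK (selfLoopGraph q) 𝓑)
    (P : Plant n GP 𝓑) {a b d : StateIdx n} (hab : a.1 ≠ b.1) (hadj : GP.Adj a.1 b.1)
    (hd : (P.A + P.B * Γ P) a d ≠ 0) :
    ∃ P' : Plant n GP 𝓑, cost Q R P' (deadbeat P') < cost Q R P' (Γ P') := by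
  set x₀ : StateIdx n → ℝ := Pi.single d 1 with hx₀
  obtain ⟨C, hC⟩ := h𝓑.exists_cost_deadbeat_drivenPlant hε hQ hR hRd P hadj x₀
  set c := (P.A + P.B * Γ P) a d with hc
  set ρ := R b b with hρ
  set τ := R.col b ⬝ᵥ (Q⁻¹ *ᵥ R.col b) with hτ
  have hρ0 : 0 < ρ := hR.diag_pos (i := b)
  have hc0 : 0 < c ^ 2 := by positivity
  -- Up to the factor `(r / β)²`, this is the two-step lower bound minus the part of the deadbeat
  -- cost that depends on `r`. The loss `τ / β²` tends to zero as `β` grows.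
  obtain ⟨β, hβ, hβτ⟩ : ∃ β, ε ≤ β ∧ 0 < c ^ 2 * ρ - τ / β ^ 2 * (x₀ a ^ 2 + c ^ 2) := by
    have ht : Filter.Tendsto (fun β : ℝ => c ^ 2 * ρ - τ / β ^ 2 * (x₀ a ^ 2 + c ^ 2))
        Filter.atTop (nhds (c ^ 2 * ρ - 0 * (x₀ a ^ 2 + c ^ 2))) :=
      ((Filter.Tendsto.const_div_atTop (Filter.tendsto_pow_atTop two_ne_zero) τ).mul_const
        _).const_sub _
    have hpos : 0 < c ^ 2 * ρ - 0 * (x₀ a ^ 2 + c ^ 2) := by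
      rw [zero_mul, sub_zero]; positivity
    obtain ⟨β, h1, h2⟩ := ((ht.eventually_const_lt hpos).and
      (Filter.eventually_ge_atTop ε)).exists
    exact ⟨β, h2, h1⟩
  have hβ0 : 0 < β := hε.trans_le hβ
  set g := c ^ 2 * ρ - τ / β ^ 2 * (x₀ a ^ 2 + c ^ 2) with hg
  -- With `β` fixed, a large `r` outweighs `C`. The maximum with `0` also keeps the lower bound
  -- positive, as strictness under `ENNReal.ofReal` requires.
  obtain ⟨r, hr⟩ : ∃ r : ℝ, max C 0 < (r / β) ^ 2 * g ∧ 0 < r := by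
    have ht : Filter.Tendsto (fun r : ℝ => (r / β) ^ 2 * g) Filter.atTop Filter.atTop :=
      ((Filter.tendsto_pow_atTop two_ne_zero).comp
        (Filter.tendsto_id.atTop_div_const hβ0)).atTop_mul_const hβτ
    exact ((ht.eventually_gt_atTop _).and (Filter.eventually_gt_atTop 0)).exists
  set P' := h𝓑.drivenPlant P hadj hβ r x₀ with hP'
  set K := Γ P' with hK
  -- The information constraint enters here: only the model of `b.1` has changed, so `Γ` keeps block
  -- row `a.1`.
  have hrow : ∀ k e, K ⟨a.1, k⟩ e = Γ P ⟨a.1, k⟩ e := by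
    intro k e
    refine (hΓ.2 a.1 P P' (fun j hj => ?_) k e).symm
    obtain rfl : j = a.1 := hj
    exact h𝓑.sameModel_drivenPlant P hadj hβ r x₀ hab
  have hstep : ∀ k : ℕ, ∀ e : StateIdx n, e.1 = b.1 → P'.state K (k + 1) e =
      (r * P'.state K k a) * (Pi.single b 1 : StateIdx n → ℝ) e + β * P'.input K k e := by
    intro k e he
    have h1 : (P'.A *ᵥ P'.state K k) e = _ := setDriver_mulVec_of_eq P.A b a r _ he
    have h2 : (P'.B *ᵥ P'.input K k) e = _ := setInputBlock_mulVec_of_eq P.B β _ he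
    rw [← h1, ← h2]
    rfl
  -- Hence `x(1)` at `a` is `c ≠ 0`, whatever `β` and `r` are.
  have hx1 : P'.state K 1 a = c := by
    have h1 : (P'.A *ᵥ x₀) a = _ := setDriver_mulVec_of_ne P.A b a r _ hab
    have h2 : (P'.B *ᵥ (K *ᵥ x₀)) a = _ := setInputBlock_mulVec_of_ne P.B β _ hab
    have h3 : P'.state K 1 a = (P'.A *ᵥ x₀) a + (P'.B *ᵥ (K *ᵥ x₀)) a := rfl
    have h4 : (P.B *ᵥ (K *ᵥ x₀)) a = (P.B *ᵥ (Γ P *ᵥ x₀)) a := by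
      have hBd := h𝓑.blockDiag _ P.B_mem
      obtain ⟨i, k⟩ := a
      rw [hBd.mulVec_apply, hBd.mulVec_apply]
      simp [hx₀, hrow]
    rw [h3, h1, h2, h4, hc, Matrix.mulVec_mulVec, hx₀]
    simp
  have l0 := step_cost_lower_bound hQ hR hRd hβ0 _ (hstep 0)
  have l1 := step_cost_lower_bound hQ hR hRd hβ0 _ (hstep 1)
  have hx0 : P'.state K 0 a = x₀ a := rfl
  rw [hx0] at l0
  rw [hx1] at l1
  refine ⟨P', lt_of_lt_of_le ?_ (le_cost hQ hR P' K)⟩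
  rw [hC β hβ r]
  have hkey : C + (r * x₀ a / β) ^ 2 * ρ <
      (r * x₀ a / β) ^ 2 * (ρ - τ / β ^ 2) + (r * c / β) ^ 2 * (ρ - τ / β ^ 2) := by
    have h : (r * x₀ a / β) ^ 2 * (ρ - τ / β ^ 2) + (r * c / β) ^ 2 * (ρ - τ / β ^ 2) =
        (r / β) ^ 2 * g + (r * x₀ a / β) ^ 2 * ρ := by rw [hg]; ring
    rw [h]
    linarith [le_max_left C 0]
  have hpos : 0 < (r * x₀ a / β) ^ 2 * (ρ - τ / β ^ 2) + (r * c / β) ^ 2 * (ρ - τ / β ^ 2) := by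
    have h : (r * x₀ a / β) ^ 2 * (ρ - τ / β ^ 2) + (r * c / β) ^ 2 * (ρ - τ / β ^ 2) =
        (r / β) ^ 2 * g + (r * x₀ a / β) ^ 2 * ρ := by rw [hg]; ring
    rw [h]
    have : 0 < (r / β) ^ 2 * g := (le_max_right C 0).trans_lt hr.1
    positivity
  have hlow := add_le_add l0 l1
  exact (ENNReal.ofReal_lt_ofReal_iff (hpos.trans_le hlow)).mpr (hkey.trans_le hlow)

/-- At a plant of strict improvement `Γ` differs from deadbeat, so `A + BΓ(P)` has a nonzero entry;
the out-neighbour of its row then yields a plant on which `Γ` is worse. -/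
theorem InputSet.isUndominatedIn_deadbeat (h𝓑 : InputSet 𝓑 ε) (hε : 0 < ε)
    (hn : ∀ i, 1 ≤ n i) (hGK : GP ≤ GK) {Q R : SysMatrix n} (hQ : Q.PosDef) (hR : R.PosDef)
    (hRd : IsBlockDiag R) (hsink : ∀ i, ¬ IsSink GP i) :
    IsUndominatedIn Q R (designMethods n GP GK (selfLoopGraph q) 𝓑)
      (deadbeat : Plant n GP 𝓑 → SysMatrix n) := by
  refine ⟨h𝓑.deadbeat_mem hGK, ?_⟩
  rintro ⟨Γ, hΓ, hle, P, hlt⟩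
  obtain ⟨a, d, had⟩ : ∃ a d, (P.A + P.B * Γ P) a d ≠ 0 := by
    by_contra! h
    have hz : P.A + P.B * Γ P = 0 := by ext a d; exact h a d
    have hΓP : Γ P = deadbeat P := by
      rw [deadbeat, ← Matrix.mul_neg, ← eq_neg_of_add_eq_zero_right hz,
        Matrix.nonsing_inv_mul_cancel_left _ _ (h𝓑.isUnit _ P.B_mem)]
    exact hlt.ne (by rw [hΓP])
  obtain ⟨j, hj, hadj⟩ : ∃ j, j ≠ a.1 ∧ GP.Adj a.1 j := by
    have := hsink a.1
    rw [IsSink] at this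
    push Not at this
    exact this
  obtain ⟨P', hP'⟩ := h𝓑.exists_cost_deadbeat_lt hε hQ hR hRd hΓ P
    (b := ⟨j, ⟨0, hn j⟩⟩) hj.symm hadj had
  exact (hle P').not_gt hP'

end NoSink

end LimitedModelInfo

open LimitedModelInfo in
theorem mainTheorem3 {q : ℕ} (n : Fin q → ℕ) (hn : ∀ i, 1 ≤ n i)
    (GP GK : Digraph (Fin q)) (hiso : ∀ i, ¬ IsIsolated GP i) (hGK : GP ≤ GK)
    (ε : ℝ) (hε : 0 < ε)
    (Q R : SysMatrix n) (hQ : Q.PosDef) (hQd : IsBlockDiag Q) (hR : R.PosDef) (hRd : IsBlockDiag R)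
    (𝓑 : Set (SysMatrix n)) (h𝓑 : 𝓑 = inputMatrices n ε ∨ 𝓑 = diagInputMatrices n ε) :
    (deadbeat : Plant n GP 𝓑 → SysMatrix n) ∈ designMethods n GP GK (selfLoopGraph q) 𝓑 ∧
    (IsUndominatedIn Q R (designMethods n GP GK (selfLoopGraph q) 𝓑)
        (deadbeat : Plant n GP 𝓑 → SysMatrix n) ↔
      ∀ i, ¬ IsSink GP i) := by
  have hI : InputSet 𝓑 ε := by
    rcases h𝓑 with rfl | rfl
    exacts [inputSet_inputMatrices hε, inputSet_diagInputMatrices hε]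
  refine ⟨hI.deadbeat_mem hGK, fun h i hi => h.2 ?_, fun h =>
    hI.isUndominatedIn_deadbeat hε hn hGK hQ hR hRd h⟩
  exact hI.exists_dominates_of_isSink hε hn hGK hQ hR hRd hi (hiso i)
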